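/- Let $n,k\ge 0$ be integers, $\alpha\in\{0,1\}^n$ with Hamming weight $w=|\alpha|$, and $$f(x)=\Big(\sum_{i=1}^n\alpha_i x_i\Big)\sum_{i=1}^n x_i+\sum_{i=1}^{n-k+1}C_{i:i+k-1}(x)\pmod 2,\qquad x\in\{0,1\}^n,$$ where each $C_{i:i+k-1}$ is a sum of degree-$3$ monomials in $k$ consecutive variables $x_i,\dots,x_{i+k-1}$. Let $C=H^{\otimes n}DH^{\otimes n}$ be an IQP circuit in which $D$ is a product, in any order, of $Z$, $CZ$ and $CCZ$ gates with $D|x\rangle=(-1)^{f(x)}|x\rangle$. Let $G$ be the tensor network of the amplitude $\langle 0^n|C|0^n\rangle$: one vertex for every gate, for every input $|0\rangle$ and for every output $\langle 0|$, and one edge of dimension $2$ for every wire segment between them. Contracting an edge merges its end points into one vertex, which keeps all other edges incident to them. The complexity of an ordering of the edges of $G$ is the maximum degree (an uncontracted loop counting once) of the merged vertices that are formed when the edges are contracted in this order, and the contraction complexity $\mathrm{cc}(G)$ is the minimum over all orderings. Then: 1. $\displaystyle \mathrm{cc}(G)\ \ge\ \frac{\min(w,n-w)-1}{2}.$ 2.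 Tensor-network simulation takes exponential time and space when $w$ is a constant fraction of $n$: for every $\delta>0$ there are $\varepsilon>0$ and $N$, depending only on $\delta$, such that whenever $n\ge N$ and $\delta n\le w\le(1-\delta)n$ (for example $w=n/c$ with a constant $c>1$ and $\delta=\min(1/c,1-1/c)$), every contraction of $G$, for all $k,\alpha,C_{i:i+k-1},D$ as above, takes time at least $2^{\varepsilon n}$ and space at least $2^{\varepsilon n}$. Here a contraction is a sequence of steps, each of which contracts a nonempty set of edges with the same end points (a single edge, or for instance all edges shared by two tensors), until no edge is left. Its time is the total number of additions and multiplications of complex numbers when the merged tensors are computed entry by entry as sums over the contracted indices, and its space is the largest number of tensor entries stored at any moment. -/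

import Mathlib

open Finset

noncomputable section

namespace TN

/-! ### Tensors, tensor networks and their contraction -/

section Networks

variable {E : Type*} [DecidableEq E]

/-- A tensor whose legs, all of dimension two, are labelled by a finite set of edges. -/
structure Tensor (E : Type*) where
  legs : Finset E
  entry : (legs → Bool) → ℂ

/-- Extend an assignment of the legs in `s` to all edges (the value off `s` is irrelevant). -/
def extend (s : Finset E) (x : s → Bool) : E → Bool :=
  fun l => if h : l ∈ s then x ⟨l, h⟩ else false

/-- The tensor with legs `s` whose entries are given by a function of the edge variables. -/
def Tensor.ofFun (s : Finset E) (g : (E → Bool) → ℂ) : Tensor E where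
  legs := s
  entry x := g (extend s x)

/-- A tensor network without open legs: the vertices of its graph are the tensors in the list,
its edges are the labels of the legs, and an edge joins the tensors that carry its label. -/
abbrev Network (E : Type*) := List (Tensor E)

/-- All edges that are incident to some tensor of the list. -/
def edges (N : Network E) : Finset E :=
  (N.map Tensor.legs).foldr (· ∪ ·) ∅

/-- The tensors of `N` that carry an edge of `F`. -/
def incident (N : Network E) (F : Finset E) : Network E :=
  N.filter fun T => decide (T.legs ∩ F).Nonempty

/-- The tensors of `N` that carry no edge of `F`. -/
def avoiding (N : Network E) (F : Finset E) : Network E :=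
  N.filter fun T => decide ¬ (T.legs ∩ F).Nonempty

/-- Merge the tensors of a list: multiply them and sum over the variables of the edges in `F`.
The remaining legs are kept, each once. -/
def merge (Ts : Network E) (F : Finset E) : Tensor E where
  legs := edges Ts \ F
  entry x := ∑ b : F → Bool, (Ts.map fun T => T.entry fun l =>
    if h : l.1 ∈ F then b ⟨l.1, h⟩ else extend (edges Ts \ F) x l.1).prod

/-- The merged vertex that is formed when the edges of `F` are contracted in `N`. -/
def mergedVertex (N : Network E) (F : Finset E) : Tensor E :=
  merge (incident N F) F

/-- Contract the edges of `F`: their end points are replaced by the merged vertex. -/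
def contract (N : Network E) (F : Finset E) : Network E :=
  mergedVertex N F :: avoiding N F

/-- `π` enumerates every edge of the network exactly once. -/
def IsEdgeOrdering (N : Network E) (π : List E) : Prop :=
  π.Nodup ∧ ∀ e, e ∈ π ↔ e ∈ edges N

/-- The complexity of an ordering of the edges: the maximum degree of the merged vertices formed
when the edges are contracted one after the other in this order. An edge that has become a loop
counts once in the degree, until it is contracted. -/
def orderingComplexity (N : Network E) : List E → ℕ
  | [] => 0
  | e :: π => max (mergedVertex N {e}).legs.card (orderingComplexity (contract N {e}) π)

/-- The contraction complexity of a network: the minimum over all orderings of its edges. -/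
def contractionComplexity (N : Network E) : ℕ :=
  sInf {c | ∃ π, IsEdgeOrdering N π ∧ c = orderingComplexity N π}

/-- A run of the contraction algorithm. Each step contracts a nonempty block of parallel edges
(edges with the same end points, in particular a single edge, or all edges shared by two tensors,
or loops at one tensor), until no edge is left. Runs all of whose blocks are single edges are the
orderings of the edges. -/
def IsRun (N : Network E) : List (Finset E) → Prop
  | [] => edges N = ∅
  | F :: σ => F.Nonempty ∧ F ⊆ edges N ∧
      (∀ T ∈ N, (T.legs ∩ F).Nonempty → F ⊆ T.legs) ∧ IsRun (contract N F) σ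

/-- Arithmetic operations on complex numbers spent on computing the merged vertex entry by entry:
each of its `2 ^ deg` entries is a sum of `2 ^ |F|` terms, each of which is a product of one
entry of every tensor that is merged. -/
def stepTime (N : Network E) (F : Finset E) : ℕ :=
  2 ^ (mergedVertex N F).legs.card *
    (((incident N F).length - 1) * 2 ^ F.card + (2 ^ F.card - 1))

/-- Time of a run: the total number of arithmetic operations. -/
def time (N : Network E) : List (Finset E) → ℕ
  | [] => 0
  | F :: σ => stepTime N F + time (contract N F) σ

/-- The number of complex numbers needed to store all tensors of a network. -/
def storage (N : Network E) : ℕ :=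
  (N.map fun T => 2 ^ T.legs.card).sum

/-- Space of a run: the largest number of complex numbers stored at any moment. -/
def space (N : Network E) : List (Finset E) → ℕ
  | [] => storage N
  | F :: σ => max (storage N) (space (contract N F) σ)

end Networks

/-! ### Circuits and their tensor networks -/

section Circuits

variable {n : ℕ}

/-- The gates: the Hadamard gate on a qubit, and the diagonal gate
`|x⟩ ↦ (-1) ^ (∏ q ∈ s, x q) |x⟩` on a set `s` of qubits, which is `Z`, `CZ` or `CCZ`
if `s` has one, two or three elements. -/
inductive Gate (n : ℕ) where
  | had (q : Fin n)
  | phase (s : Finset (Fin n))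

/-- The qubits a gate acts on. -/
def Gate.support : Gate n → Finset (Fin n)
  | had q => {q}
  | phase s => s

/-- The wire of qubit `q` is cut into segments `(q, 0), (q, 1), …` by the gates acting on it. -/
abbrev Segment (n : ℕ) := Fin n × ℕ

/-- The matrix element of a gate, as a function of the variables of the segments; `c q` is the
index of the segment of qubit `q` that enters the gate, and `c q + 1` of the one that leaves. -/
def Gate.element (c : Fin n → ℕ) : Gate n → (Segment n → Bool) → ℂ
  | had q, y => (if y (q, c q) = true ∧ y (q, c q + 1) = true then -1 else 1) / (Real.sqrt 2 : ℂ)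
  | phase s, y =>
      if ∀ q ∈ s, y (q, c q) = y (q, c q + 1) then
        (if ∀ q ∈ s, y (q, c q) = true then -1 else 1)
      else 0

/-- The tensor of a gate on `m` qubits has `2 * m` legs. -/
def Gate.tensor (c : Fin n → ℕ) (g : Gate n) : Tensor (Segment n) :=
  Tensor.ofFun (g.support.image (fun q => (q, c q)) ∪ g.support.image (fun q => (q, c q + 1)))
    (g.element c)

/-- The tensor of `|0⟩` or `⟨0|`, with a single leg. -/
def zeroTensor (l : Segment n) : Tensor (Segment n) :=
  Tensor.ofFun {l} fun y => if y l = true then 0 else 1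

/-- The tensors of a sequence of gates followed by `⟨0|` on every qubit, where `c q` is the index
of the current segment of qubit `q`. -/
def networkFrom (c : Fin n → ℕ) : List (Gate n) → Network (Segment n)
  | [] => List.ofFn fun q => zeroTensor (q, c q)
  | g :: gs => g.tensor c :: networkFrom (fun q => if q ∈ g.support then c q + 1 else c q) gs

/-- The tensor network of the amplitude `⟨0…0| C |0…0⟩` of a circuit `C`, given as the list of its
gates in the order in which they are applied. -/
def circuitNetwork (C : List (Gate n)) : Network (Segment n) :=
  (List.ofFn fun q : Fin n => zeroTensor (q, 0)) ++ networkFrom (fun _ => 0) C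

/-- The IQP circuit `H^{⊗n} D H^{⊗n}` with the diagonal gates `D`, in the given order. -/
def iqpCircuit (D : List (Finset (Fin n))) : List (Gate n) :=
  List.ofFn Gate.had ++ D.map Gate.phase ++ List.ofFn Gate.had

/-- The gates of `D` are `Z`, `CZ` and `CCZ` gates whose monomials add up to `f`, that is,
`D |x⟩ = (-1) ^ f x |x⟩`. -/
def Represents (D : List (Finset (Fin n))) (f : (Fin n → ZMod 2) → ZMod 2) : Prop :=
  (∀ s ∈ D, 1 ≤ s.card ∧ s.card ≤ 3) ∧
    ∀ x, (D.map fun s => ∏ q ∈ s, x q).sum = f x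

/-- `M s` is the set of monomials of a polynomial that consists exclusively of terms of degree
three in the `k` consecutive variables that start with the one of index `s`. -/
def IsWindowCubic (k : ℕ) (M : ℕ → Finset (Finset (Fin n))) : Prop :=
  ∀ s < n + 1 - k, ∀ t ∈ M s, t.card = 3 ∧ ∀ i ∈ t, s ≤ i.val ∧ i.val < s + k

/-- The linear-network polynomial
`(∑ i, α i * x i) * ∑ i, x i + ∑ s, C_s`, where `C_s` is the sum of the monomials in `M s` and
`s` runs through the starting points of the `n - k + 1` windows of `k` consecutive variables. -/
def linearNetworkPoly (k : ℕ) (α : Fin n → ZMod 2) (M : ℕ → Finset (Finset (Fin n)))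
    (x : Fin n → ZMod 2) : ZMod 2 :=
  (∑ i, α i * x i) * (∑ i, x i) + ∑ s ∈ range (n + 1 - k), ∑ t ∈ M s, ∏ i ∈ t, x i

/-- The tensor network of the amplitude `⟨0…0| H^{⊗n} D H^{⊗n} |0…0⟩`. -/
def iqpNetwork (D : List (Finset (Fin n))) : Network (Segment n) :=
  circuitNetwork (iqpCircuit D)

end Circuits

end TN

end

/-!
Let `w` be the weight of `α` and `m = min w (n - w)`. The second difference at the origin shows
that `x q * x r` has coefficient `α q + α r` in the polynomial, since its cubic part does not
contribute. So the circuit has a `CZ` gate on every pair of qubits of different colour, where the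
colour of `q` is `α q` (`pair_mem_of_represents`).

During a contraction every tensor stands for a cluster of original vertices, and its legs include
all edges that leave the cluster. The wires are connected, so a cluster has a leg on every wire
that it meets without containing it (`IsWiring.card_le_of_containsBoundary`). Consider the first
cluster that contains a whole wire. It meets all wires of the other colour, because of the `CZ`
gates. If it contains none of these, it has at least `m` legs. Otherwise it meets all `n` wires.
An edge has at most two end points, so the cluster is the union of two earlier ones, which contain
no wire and together meet all `n ≥ 2 m` wires. Each of these two either has a leg on every wire
that it meets, or is an original vertex and meets at most three wires; they are not both original
vertices, since a wire has more than two. Hence a merged vertex has at least `m` or `2 m - 3` legs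
(`IsWiring.not_containsWire_union`, `lt_runDegree`), and both are at least `(m - 1) / 2` when
`m ≥ 2`; for `m ≤ 1` there is nothing to show. At the end no edge is left, so a cluster that
contains a whole wire must have been formed.

This holds for all runs, in particular for those that come from orderings of the edges, which gives
the bound on the contraction complexity. A merged vertex of degree `d` takes at least `2 ^ d`
operations to compute and `2 ^ d` numbers to store, which gives the bounds on time and space.
-/

namespace TN

/-! ### Contraction of general networks -/

section General

variable {E : Type*} [DecidableEq E]

theorem mem_edges {N : Network E} {e : E} : e ∈ edges N ↔ ∃ T ∈ N, e ∈ T.legs := by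
  induction N with
  | nil => simp [edges]
  | cons T N ih =>
    have h : edges (T :: N) = T.legs ∪ edges N := rfl
    simp [h, ih]

theorem mem_mergedVertex_legs {N : Network E} {F : Finset E} {e : E} :
    e ∈ (mergedVertex N F).legs ↔
      (∃ T ∈ N, (T.legs ∩ F).Nonempty ∧ e ∈ T.legs) ∧ e ∉ F := by
  have h : (mergedVertex N F).legs = edges (incident N F) \ F := rfl
  simp only [h, mem_sdiff, mem_edges, incident, List.mem_filter, decide_eq_true_eq, and_assoc]

theorem edges_contract (N : Network E) (F : Finset E) : edges (contract N F) = edges N \ F := by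
  ext e
  simp only [mem_edges, contract, List.mem_cons, exists_eq_or_imp, mem_mergedVertex_legs,
    avoiding, List.mem_filter, decide_eq_true_eq, mem_sdiff]
  constructor
  · rintro (⟨⟨T, hT, -, he⟩, heF⟩ | ⟨T, ⟨hT, hF⟩, he⟩)
    · exact ⟨⟨T, hT, he⟩, heF⟩
    · exact ⟨⟨T, hT, he⟩, fun heF => hF ⟨e, mem_inter.2 ⟨he, heF⟩⟩⟩
  · rintro ⟨⟨T, hT, he⟩, heF⟩
    by_cases hF : (T.legs ∩ F).Nonempty
    · exact Or.inl ⟨⟨T, hT, hF, he⟩, heF⟩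
    · exact Or.inr ⟨T, ⟨hT, hF⟩, he⟩

/-- The number of end points of an edge, a loop being counted once. -/
def endpoints (N : Network E) (e : E) : ℕ :=
  N.countP fun T => decide (e ∈ T.legs)

theorem endpoints_contract_le (N : Network E) (F : Finset E) (e : E) :
    endpoints (contract N F) e ≤ endpoints N e := by
  have hsplit := List.countP_eq_countP_filter_add N (fun T => decide (e ∈ T.legs))
    (fun T => decide (T.legs ∩ F).Nonempty)
  have hav : List.filter (fun T => !decide (T.legs ∩ F).Nonempty) N = avoiding N F :=
    List.filter_congr fun T _ => by simp only [decide_not]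
  rw [hav] at hsplit
  unfold endpoints
  rw [hsplit, contract, List.countP_cons]
  split_ifs with h
  · rw [decide_eq_true_eq, mem_mergedVertex_legs] at h
    obtain ⟨⟨T, hT, hF, he⟩, -⟩ := h
    have : 0 < List.countP (fun T => decide (e ∈ T.legs))
        (List.filter (fun T => decide (T.legs ∩ F).Nonempty) N) :=
      List.countP_pos_iff.2 ⟨T, by simp [hT, hF], by simp [he]⟩
    omega
  · omega

/-- The maximum degree of the merged vertices that are formed in a run. -/
def runDegree (N : Network E) : List (Finset E) → ℕ
  | [] => 0
  | F :: σ => max (mergedVertex N F).legs.card (runDegree (contract N F) σ)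

theorem orderingComplexity_eq_runDegree (N : Network E) (π : List E) :
    orderingComplexity N π = runDegree N (π.map fun e => {e}) := by
  induction π generalizing N with
  | nil => rfl
  | cons e π ih => simp only [orderingComplexity, List.map_cons, runDegree, ih]

theorem IsEdgeOrdering.isRun {N : Network E} {π : List E} (h : IsEdgeOrdering N π) :
    IsRun N (π.map fun e => {e}) := by
  induction π generalizing N with
  | nil =>
    simp only [List.map_nil, IsRun]
    exact eq_empty_of_forall_notMem fun e he => by simpa using (h.2 e).2 he
  | cons e π ih =>
    obtain ⟨hnd, hmem⟩ := h
    rw [List.nodup_cons] at hnd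
    refine ⟨singleton_nonempty e, ?_, ?_, ih ⟨hnd.2, fun a => ?_⟩⟩
    · simpa using (hmem e).1 (by simp)
    · rintro T - ⟨a, ha⟩
      rw [mem_inter, mem_singleton] at ha
      simpa [← ha.2] using ha.1
    · rw [edges_contract, mem_sdiff, mem_singleton, ← hmem a, List.mem_cons]
      constructor
      · exact fun ha => ⟨Or.inr ha, fun hae => hnd.1 (hae ▸ ha)⟩
      · exact fun ha => ha.1.resolve_left ha.2

theorem exists_run_contractionComplexity_eq (N : Network E) :
    ∃ σ, IsRun N σ ∧ contractionComplexity N = runDegree N σ := by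
  have hne : {c | ∃ π, IsEdgeOrdering N π ∧ c = orderingComplexity N π}.Nonempty :=
    ⟨_, (edges N).toList, ⟨nodup_toList _, fun _ => mem_toList⟩, rfl⟩
  obtain ⟨π, hπ, h⟩ := Nat.sInf_mem hne
  exact ⟨_, hπ.isRun, h.trans (orderingComplexity_eq_runDegree N π)⟩

theorem two_pow_le_time {N : Network E} {σ : List (Finset E)} (hσ : IsRun N σ) {d : ℕ}
    (hd : 0 < d) (h : d ≤ runDegree N σ) : 2 ^ d ≤ time N σ := by
  induction σ generalizing N with
  | nil => simp only [runDegree] at h; omega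
  | cons F σ ih =>
    obtain ⟨hF, -, -, hrun⟩ := hσ
    rw [runDegree, le_max_iff] at h
    rw [time]
    rcases h with h | h
    · have hFc : 2 ^ 1 ≤ 2 ^ F.card := Nat.pow_le_pow_right (by norm_num) hF.card_pos
      calc 2 ^ d ≤ 2 ^ (mergedVertex N F).legs.card * 1 := by
            rw [mul_one]; exact Nat.pow_le_pow_right (by norm_num) h
        _ ≤ stepTime N F := Nat.mul_le_mul_left _ (by omega)
        _ ≤ _ := Nat.le_add_right _ _
    · exact (ih hrun h).trans (Nat.le_add_left _ _)

theorem storage_le_space (N : Network E) (σ : List (Finset E)) : storage N ≤ space N σ := by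
  cases σ with
  | nil => exact le_rfl
  | cons F σ => exact le_max_left _ _

theorem two_pow_le_space {N : Network E} {σ : List (Finset E)} {d : ℕ}
    (hd : 0 < d) (h : d ≤ runDegree N σ) : 2 ^ d ≤ space N σ := by
  induction σ generalizing N with
  | nil => simp only [runDegree] at h; omega
  | cons F σ ih =>
    rw [runDegree, le_max_iff] at h
    rw [space]
    refine le_max_of_le_right ?_
    rcases h with h | h
    · calc 2 ^ d ≤ 2 ^ (mergedVertex N F).legs.card := Nat.pow_le_pow_right (by norm_num) h
        _ ≤ storage (contract N F) := by simp [storage, contract]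
        _ ≤ _ := storage_le_space _ _
    · exact ih h

end General

/-! ### Clusters of tensors and wires -/

section Clusters

variable {Q V : Type*} [DecidableEq Q]

/-- The wires that a set of vertices meets, where `inc v` is the set of segments at `v`. -/
def wiresHit (inc : V → Finset (Q × ℕ)) (S : Finset V) : Finset Q :=
  S.biUnion fun v => (inc v).image Prod.fst

theorem wiresHit_union [DecidableEq V] (inc : V → Finset (Q × ℕ)) (A B : Finset V) :
    wiresHit inc (A ∪ B) = wiresHit inc A ∪ wiresHit inc B :=
  union_biUnion

/-- `S` contains every vertex on the wire `q`. -/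
def ContainsWire (inc : V → Finset (Q × ℕ)) (S : Finset V) (q : Q) : Prop :=
  ∀ v, q ∈ (inc v).image Prod.fst → v ∈ S

/-- `L` contains every edge between `S` and its complement. -/
def ContainsBoundary (inc : V → Finset (Q × ℕ)) (S : Finset V) (L : Finset (Q × ℕ)) : Prop :=
  ∀ v ∈ S, ∀ u ∉ S, ∀ e ∈ inc v, e ∈ inc u → e ∈ L

/-- The features of a network that matter for the lower bound: every wire is connected and passes
through at least three vertices, a vertex meets at most three wires, and wires of different
colours `a` meet in a vertex. -/
structure IsWiring (inc : V → Finset (Q × ℕ)) (a : Q → Prop) : Prop where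
  connected : ∀ q S, q ∈ wiresHit inc S → ¬ ContainsWire inc S q →
    ∃ v ∈ S, ∃ u ∉ S, ∃ j, (q, j) ∈ inc v ∧ (q, j) ∈ inc u
  three_le : ∀ q S, ContainsWire inc S q → 3 ≤ S.card
  card_le : ∀ v, ((inc v).image Prod.fst).card ≤ 3
  cross : ∀ q r, a q → ¬ a r → ∃ v, q ∈ (inc v).image Prod.fst ∧ r ∈ (inc v).image Prod.fst

variable {inc : V → Finset (Q × ℕ)} {a : Q → Prop}

/-- A wire that a cluster meets without containing it crosses the boundary of the cluster. -/
theorem IsWiring.card_le_of_containsBoundary (hw : IsWiring inc a) {S : Finset V}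
    {L : Finset (Q × ℕ)} (hL : ContainsBoundary inc S L) {X : Finset Q}
    (hX : ∀ q ∈ X, q ∈ wiresHit inc S ∧ ¬ ContainsWire inc S q) : X.card ≤ L.card := by
  refine (card_le_card fun q hq => ?_).trans (card_image_le (s := L) (f := Prod.fst))
  obtain ⟨v, hv, u, hu, j, hjv, hju⟩ := hw.connected q S (hX q hq).1 (hX q hq).2
  exact mem_image.2 ⟨_, hL v hv u hu _ hjv hju, rfl⟩

/-- The cluster is at most one vertex, or it meets at most `b` wires. Clusters that contain no wire
are of this kind when merged vertices have degree at most `b`. -/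
def IsSmall (inc : V → Finset (Q × ℕ)) (b : ℕ) (S : Finset V) : Prop :=
  S.card ≤ 1 ∨ (wiresHit inc S).card ≤ b

theorem IsWiring.card_wiresHit_le_three (hw : IsWiring inc a) {S : Finset V} (hS : S.card ≤ 1) :
    (wiresHit inc S).card ≤ 3 := by
  refine (card_biUnion_le_card_mul S _ 3 fun v _ => hw.card_le v).trans ?_
  omega

/-- If the union of two small clusters contains a wire, then it either has a large boundary
or meets all wires, and both are excluded when `b` is small. -/
theorem IsWiring.not_containsWire_union [DecidableEq V] [Fintype Q] (hw : IsWiring inc a)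
    [DecidablePred a]
    {m b : ℕ} (hm₁ : m ≤ #{q | a q}) (hm₂ : m ≤ #{q | ¬ a q}) (hb : b < m)
    (hb' : b + 3 < 2 * m) {A B : Finset V} (hA : IsSmall inc b A) (hB : IsSmall inc b B)
    {L : Finset (Q × ℕ)} (hL : ContainsBoundary inc (A ∪ B) L) (hLb : L.card ≤ b) (q : Q) :
    ¬ ContainsWire inc (A ∪ B) q := by
  intro hq
  have hit₁ : ∀ {q r}, ContainsWire inc (A ∪ B) q → a q → ¬ a r →
      r ∈ wiresHit inc (A ∪ B) := fun {q r} h h₁ h₂ => by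
    obtain ⟨v, hv, hv'⟩ := hw.cross q r h₁ h₂
    exact mem_biUnion.2 ⟨v, h v hv, hv'⟩
  have hit₂ : ∀ {q r}, ContainsWire inc (A ∪ B) r → a q → ¬ a r →
      q ∈ wiresHit inc (A ∪ B) := fun {q r} h h₁ h₂ => by
    obtain ⟨v, hv, hv'⟩ := hw.cross q r h₁ h₂
    exact mem_biUnion.2 ⟨v, h v hv', hv⟩
  -- Too few edges leave the cluster, so among the wires of the other colour that it meets there
  -- is one that it contains.
  have both : (∃ q, a q ∧ ContainsWire inc (A ∪ B) q) ∧
      (∃ r, ¬ a r ∧ ContainsWire inc (A ∪ B) r) := by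
    by_cases haq : a q
    · refine ⟨⟨q, haq, hq⟩, ?_⟩
      by_contra! hno
      have := hw.card_le_of_containsBoundary hL (X := {q | ¬ a q}) fun r hr => by
        have hr := (mem_filter.1 hr).2
        exact ⟨hit₁ hq haq hr, hno r hr⟩
      omega
    · refine ⟨?_, ⟨q, haq, hq⟩⟩
      by_contra! hno
      have := hw.card_le_of_containsBoundary hL (X := {q | a q}) fun r hr => by
        have hr := (mem_filter.1 hr).2
        exact ⟨hit₂ hq hr haq, hno r hr⟩
      omega
  obtain ⟨⟨q₁, ha₁, hq₁⟩, ⟨q₂, ha₂, hq₂⟩⟩ := both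
  have hall : wiresHit inc (A ∪ B) = univ := eq_univ_of_forall fun r => by
    by_cases hr : a r
    · exact hit₂ hq₂ hr ha₂
    · exact hit₁ hq₁ ha₁ hr
  have hn : 2 * m ≤ (wiresHit inc (A ∪ B)).card := by
    have : #{q | a q} + #{q | ¬ a q} = #(univ : Finset Q) := card_filter_add_card_filter_not _
    rw [hall]
    omega
  rw [wiresHit_union] at hn
  have hn := hn.trans (card_union_le _ _)
  have h3 := hw.three_le q _ hq
  have hAB := card_union_le A B
  rcases hA with hA | hA <;> rcases hB with hB | hB
  · omega
  · have := hw.card_wiresHit_le_three hA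
    omega
  · have := hw.card_wiresHit_le_three hB
    omega
  · omega

/-- A network, each tensor paired with the cluster of original vertices that were merged into it,
at a moment when all clusters are small and none contains a wire. -/
structure IsScattered (inc : V → Finset (Q × ℕ)) (b : ℕ)
    (P : List (Tensor (Q × ℕ) × Finset V)) : Prop where
  cover : ∀ v, ∃ p ∈ P, v ∈ p.2
  disjoint : ∀ p ∈ P, ∀ p' ∈ P, ∀ v, v ∈ p.2 → v ∈ p'.2 → p = p'
  boundary : ∀ p ∈ P, ContainsBoundary inc p.2 p.1.legs
  endpoints_le : ∀ e, endpoints (P.map Prod.fst) e ≤ 2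
  not_containsWire : ∀ p ∈ P, ∀ q, ¬ ContainsWire inc p.2 q
  small : ∀ p ∈ P, IsSmall inc b p.2

/-- The cluster of the vertex that is formed when the edges of `F` are contracted. -/
def mergedCluster [DecidableEq V] (P : List (Tensor (Q × ℕ) × Finset V)) (F : Finset (Q × ℕ)) :
    Finset V :=
  ((P.filter fun p => decide (p.1.legs ∩ F).Nonempty).map Prod.snd).foldr (· ∪ ·) ∅

/-- Contract the edges of `F` and keep track of the clusters. -/
def contractClusters [DecidableEq V] (P : List (Tensor (Q × ℕ) × Finset V))
    (F : Finset (Q × ℕ)) : List (Tensor (Q × ℕ) × Finset V) :=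
  (mergedVertex (P.map Prod.fst) F, mergedCluster P F) ::
    P.filter fun p => decide ¬ (p.1.legs ∩ F).Nonempty

variable [DecidableEq V]

theorem map_fst_contractClusters (P : List (Tensor (Q × ℕ) × Finset V)) (F : Finset (Q × ℕ)) :
    (contractClusters P F).map Prod.fst = contract (P.map Prod.fst) F := by
  simp only [contractClusters, contract, List.map_cons, avoiding, List.filter_map]
  rfl

theorem mem_mergedCluster {P : List (Tensor (Q × ℕ) × Finset V)} {F : Finset (Q × ℕ)} {v : V} :
    v ∈ mergedCluster P F ↔ ∃ p ∈ P, (p.1.legs ∩ F).Nonempty ∧ v ∈ p.2 := by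
  induction P with
  | nil => simp [mergedCluster]
  | cons p P ih =>
    rw [mergedCluster] at ih ⊢
    by_cases h : (p.1.legs ∩ F).Nonempty <;> simp [h, ih]

theorem IsScattered.boundary_mergedCluster {b : ℕ} {P : List (Tensor (Q × ℕ) × Finset V)}
    (hP : IsScattered inc b P) (F : Finset (Q × ℕ)) :
    ContainsBoundary inc (mergedCluster P F) (mergedVertex (P.map Prod.fst) F).legs := by
  intro v hv u hu e hev heu
  obtain ⟨p, hp, hpF, hvp⟩ := mem_mergedCluster.1 hv
  have hup : u ∉ p.2 := fun h => hu (mem_mergedCluster.2 ⟨p, hp, hpF, h⟩)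
  refine mem_mergedVertex_legs.2
    ⟨⟨p.1, List.mem_map_of_mem hp, hpF, hP.boundary p hp v hvp u hup e hev heu⟩, fun heF => hu ?_⟩
  -- An edge of `F` that leaves the cluster of `p` ends in another tensor that is merged.
  obtain ⟨p', hp', hup'⟩ := hP.cover u
  by_cases hvp' : v ∈ p'.2
  · exact absurd (hP.disjoint p hp p' hp' v hvp hvp' ▸ hup') hup
  · exact mem_mergedCluster.2 ⟨p', hp',
      ⟨e, mem_inter.2 ⟨hP.boundary p' hp' u hup' v hvp' e heu hev, heF⟩⟩, hup'⟩

theorem IsScattered.exists_mergedCluster_eq_union {b : ℕ}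
    {P : List (Tensor (Q × ℕ) × Finset V)} (hP : IsScattered inc b P) {F : Finset (Q × ℕ)}
    (hF : F.Nonempty) (hpar : ∀ p ∈ P, (p.1.legs ∩ F).Nonempty → F ⊆ p.1.legs) :
    ∃ A B, IsSmall inc b A ∧ IsSmall inc b B ∧ mergedCluster P F = A ∪ B := by
  obtain ⟨e, he⟩ := hF
  have hlen : (P.filter fun p => decide (p.1.legs ∩ F).Nonempty).length ≤ 2 := by
    refine le_trans ?_ (hP.endpoints_le e)
    rw [endpoints, List.countP_map, ← List.countP_eq_length_filter]
    refine List.countP_mono_left fun p hp h => ?_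
    simpa using hpar p hp (of_decide_eq_true h) he
  have hsmall : ∀ p ∈ P.filter fun p => decide (p.1.legs ∩ F).Nonempty, IsSmall inc b p.2 :=
    fun p hp => hP.small p (List.mem_filter.1 hp).1
  have hempty : IsSmall inc b ∅ := Or.inl (by simp)
  rw [mergedCluster]
  match h : P.filter fun p => decide (p.1.legs ∩ F).Nonempty with
  | [] => exact ⟨∅, ∅, hempty, hempty, by rw [h]; rfl⟩
  | [p] => exact ⟨p.2, ∅, hsmall p (by simp [h]), hempty, by rw [h]; rfl⟩
  | [p, p'] => exact ⟨p.2, p'.2, hsmall p (by simp [h]), hsmall p' (by simp [h]), by rw [h]; simp⟩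
  | p :: p' :: p'' :: l => rw [h] at hlen; simp at hlen

/-- As long as the merged vertices have degree at most `b`, all clusters stay small and none
contains a wire. -/
theorem IsScattered.contractClusters [Fintype Q] [DecidablePred a] (hw : IsWiring inc a)
    {m b : ℕ} (hm₁ : m ≤ #{q | a q}) (hm₂ : m ≤ #{q | ¬ a q}) (hb : b < m)
    (hb' : b + 3 < 2 * m) {P : List (Tensor (Q × ℕ) × Finset V)} (hP : IsScattered inc b P)
    {F : Finset (Q × ℕ)} (hF : F.Nonempty)
    (hpar : ∀ p ∈ P, (p.1.legs ∩ F).Nonempty → F ⊆ p.1.legs)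
    (hdeg : (mergedVertex (P.map Prod.fst) F).legs.card ≤ b) :
    IsScattered inc b (contractClusters P F) := by
  have hbd := hP.boundary_mergedCluster F
  have hfull : ∀ q, ¬ ContainsWire inc (mergedCluster P F) q := by
    obtain ⟨A, B, hA, hB, hAB⟩ := hP.exists_mergedCluster_eq_union hF hpar
    rw [hAB] at hbd ⊢
    exact hw.not_containsWire_union hm₁ hm₂ hb hb' hA hB hbd hdeg
  have hmem : ∀ {p}, p ∈ P.filter (fun p => decide ¬ (p.1.legs ∩ F).Nonempty) ↔
      p ∈ P ∧ ¬ (p.1.legs ∩ F).Nonempty := by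
    intro p
    rw [List.mem_filter, decide_eq_true_eq]
  have hdisj : ∀ p ∈ P, ¬ (p.1.legs ∩ F).Nonempty → ∀ v ∈ p.2, v ∉ mergedCluster P F := by
    intro p hp hpF v hv hv'
    obtain ⟨p', hp', hpF', hv'⟩ := mem_mergedCluster.1 hv'
    exact hpF (hP.disjoint p hp p' hp' v hv hv' ▸ hpF')
  constructor
  · intro v
    obtain ⟨p, hp, hv⟩ := hP.cover v
    by_cases hpF : (p.1.legs ∩ F).Nonempty
    · exact ⟨_, List.mem_cons_self, mem_mergedCluster.2 ⟨p, hp, hpF, hv⟩⟩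
    · exact ⟨p, List.mem_cons_of_mem _ (hmem.2 ⟨hp, hpF⟩), hv⟩
  · intro p hp p' hp' v hv hv'
    rcases List.mem_cons.1 hp with rfl | hp <;> rcases List.mem_cons.1 hp' with rfl | hp'
    · rfl
    · exact absurd hv (hdisj p' (hmem.1 hp').1 (hmem.1 hp').2 v hv')
    · exact absurd hv' (hdisj p (hmem.1 hp).1 (hmem.1 hp).2 v hv)
    · exact hP.disjoint p (hmem.1 hp).1 p' (hmem.1 hp').1 v hv hv'
  · exact List.forall_mem_cons.2 ⟨hbd, fun p hp => hP.boundary p (hmem.1 hp).1⟩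
  · intro e
    rw [map_fst_contractClusters]
    exact (endpoints_contract_le _ F e).trans (hP.endpoints_le e)
  · exact List.forall_mem_cons.2 ⟨hfull, fun p hp => hP.not_containsWire p (hmem.1 hp).1⟩
  · refine List.forall_mem_cons.2 ⟨Or.inr ?_, fun p hp => hP.small p (hmem.1 hp).1⟩
    exact (hw.card_le_of_containsBoundary hbd fun q hq => ⟨hq, hfull q⟩).trans hdeg

theorem IsScattered.lt_runDegree [Fintype Q] [DecidablePred a] (hw : IsWiring inc a)
    {m b : ℕ} (hm₁ : m ≤ #{q | a q}) (hm₂ : m ≤ #{q | ¬ a q}) (hb : b < m)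
    (hb' : b + 3 < 2 * m) {P : List (Tensor (Q × ℕ) × Finset V)} (hP : IsScattered inc b P)
    {σ : List (Finset (Q × ℕ))} (hσ : IsRun (P.map Prod.fst) σ) :
    b < runDegree (P.map Prod.fst) σ := by
  induction σ generalizing P with
  | nil =>
    -- Some vertex lies on two wires; its cluster contains neither, so it has an uncontracted leg.
    obtain ⟨q, hq⟩ : (univ.filter fun q => a q).Nonempty := card_pos.1 (by omega)
    obtain ⟨r, hr⟩ : (univ.filter fun q => ¬ a q).Nonempty := card_pos.1 (by omega)
    obtain ⟨v, hv, -⟩ := hw.cross q r (mem_filter.1 hq).2 (mem_filter.1 hr).2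
    obtain ⟨p, hp, hvp⟩ := hP.cover v
    obtain ⟨v, hv, u, hu, j, hjv, hju⟩ :=
      hw.connected q p.2 (mem_biUnion.2 ⟨v, hvp, hv⟩) (hP.not_containsWire p hp q)
    have : (q, j) ∈ edges (P.map Prod.fst) :=
      mem_edges.2 ⟨p.1, List.mem_map_of_mem hp, hP.boundary p hp v hv u hu _ hjv hju⟩
    rw [IsRun] at hσ
    simp [hσ] at this
  | cons F σ ih =>
    obtain ⟨hF, -, hpar, hrun⟩ := hσ
    rw [runDegree, lt_max_iff]
    by_contra! h
    rw [← map_fst_contractClusters] at hrun h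
    have hP' := hP.contractClusters hw hm₁ hm₂ hb hb' hF
      (fun p hp => hpar p.1 (List.mem_map_of_mem hp)) h.1
    exact absurd (ih hP' hrun) (not_lt.2 h.2)

end Clusters

/-- The legs of the tensors of a network, as a function of their positions in the list. -/
def legsAt {E : Type*} (N : Network E) (v : Fin N.length) : Finset E :=
  (N.get v).legs

theorem isScattered_singletons {Q : Type*} [DecidableEq Q] {a : Q → Prop} (N : Network (Q × ℕ))
    (hw : IsWiring (legsAt N) a) (hN : ∀ e, endpoints N e ≤ 2) (b : ℕ) :
    IsScattered (legsAt N) b (List.ofFn fun v : Fin N.length => (N.get v, {v})) := by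
  constructor
  · exact fun v => ⟨(N.get v, {v}), List.mem_ofFn.2 ⟨v, rfl⟩, mem_singleton_self v⟩
  · simp only [List.forall_mem_ofFn_iff, mem_singleton]
    rintro v u _ rfl rfl
    rfl
  · simp only [List.forall_mem_ofFn_iff]
    intro v w hw u _ e he _
    rwa [mem_singleton.1 hw] at he
  · simpa [List.map_ofFn, Function.comp_def] using hN
  · simp only [List.forall_mem_ofFn_iff]
    intro v q h
    have := hw.three_le q _ h
    simp at this
  · simp only [List.forall_mem_ofFn_iff]
    exact fun v => Or.inl (card_singleton v).le

/-- Every run on a network in which `m` wires of one colour are joined to `m` wires of another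
colour forms a merged vertex of degree at least `min m (2 * m - 3)`. -/
theorem lt_runDegree {Q : Type*} [DecidableEq Q] [Fintype Q] {a : Q → Prop} [DecidablePred a]
    {N : Network (Q × ℕ)} (hw : IsWiring (legsAt N) a) (hN : ∀ e, endpoints N e ≤ 2)
    {m b : ℕ} (hm₁ : m ≤ #{q | a q}) (hm₂ : m ≤ #{q | ¬ a q}) (hb : b < m)
    (hb' : b + 3 < 2 * m) {σ : List (Finset (Q × ℕ))} (hσ : IsRun N σ) : b < runDegree N σ := by
  have hmap : (List.ofFn fun v : Fin N.length => (N.get v, ({v} : Finset _))).map Prod.fst = N := by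
    simp [List.map_ofFn, Function.comp_def]
  have := (isScattered_singletons N hw hN b).lt_runDegree hw hm₁ hm₂ hb hb' (σ := σ)
  rw [hmap] at this
  exact this hσ

/-! ### The network of a circuit -/

section Circuits

variable {n : ℕ}

theorem Gate.mem_legs_tensor {c : Fin n → ℕ} {g : Gate n} {q : Fin n} {j : ℕ} :
    (q, j) ∈ (g.tensor c).legs ↔ q ∈ g.support ∧ (j = c q ∨ j = c q + 1) := by
  have h : (g.tensor c).legs =
    g.support.image (fun q => (q, c q)) ∪ g.support.image (fun q => (q, c q + 1)) := rfl
  rw [h, mem_union, mem_image, mem_image]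
  grind

theorem mem_legs_zeroTensor {l e : Segment n} : e ∈ (zeroTensor l).legs ↔ e = l :=
  mem_singleton

theorem Gate.mem_wires_tensor {c : Fin n → ℕ} {g : Gate n} {q : Fin n} :
    q ∈ (g.tensor c).legs.image Prod.fst ↔ q ∈ g.support := by
  simp only [mem_image, Prod.exists, Gate.mem_legs_tensor]
  grind

theorem wires_zeroTensor (l : Segment n) : (zeroTensor l).legs.image Prod.fst = {l.1} :=
  image_singleton _ _

theorem exists_tensor_mem_networkFrom {gs : List (Gate n)} {g : Gate n} (hg : g ∈ gs)
    (c : Fin n → ℕ) : ∃ c', g.tensor c' ∈ networkFrom c gs := by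
  induction gs generalizing c with
  | nil => simp at hg
  | cons g' gs ih =>
    rcases List.mem_cons.1 hg with rfl | hg
    · exact ⟨c, List.mem_cons_self⟩
    · obtain ⟨c', hc'⟩ := ih hg _
      exact ⟨c', List.mem_cons_of_mem _ hc'⟩

theorem forall_mem_networkFrom {p : Tensor (Segment n) → Prop} {gs : List (Gate n)}
    (hz : ∀ l, p (zeroTensor l)) (hg : ∀ g ∈ gs, ∀ c, p (g.tensor c)) (c : Fin n → ℕ) :
    ∀ T ∈ networkFrom c gs, p T := by
  induction gs generalizing c with
  | nil => simpa [networkFrom, List.forall_mem_ofFn_iff] using fun q => hz _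
  | cons g gs ih =>
    exact List.forall_mem_cons.2 ⟨hg g List.mem_cons_self c,
      ih (fun g' hg' => hg g' (List.mem_cons_of_mem _ hg')) _⟩

/-- Every segment but the current one of a qubit leaves a tensor that the preceding segment
enters. -/
theorem exists_source_networkFrom (gs : List (Gate n)) (c : Fin n → ℕ) {q : Fin n} {j : ℕ} :
    ∀ T ∈ networkFrom c gs, (q, j) ∈ T.legs → j = c q ∨
      ∃ U ∈ networkFrom c gs, (q, j) ∈ U.legs ∧ ∃ i, j = i + 1 ∧ (q, i) ∈ U.legs := by
  induction gs generalizing c with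
  | nil =>
    simp only [networkFrom, List.forall_mem_ofFn_iff, mem_legs_zeroTensor, Prod.mk.injEq]
    rintro r ⟨rfl, h⟩
    exact Or.inl h
  | cons g gs ih =>
    have hgate : q ∈ g.support → j = c q + 1 → ∃ U ∈ networkFrom c (g :: gs),
        (q, j) ∈ U.legs ∧ ∃ i, j = i + 1 ∧ (q, i) ∈ U.legs := fun hq hj =>
      ⟨_, List.mem_cons_self, Gate.mem_legs_tensor.2 ⟨hq, Or.inr hj⟩, c q, hj,
        Gate.mem_legs_tensor.2 ⟨hq, Or.inl rfl⟩⟩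
    refine List.forall_mem_cons.2 ⟨fun h => ?_, fun T hT h => ?_⟩
    · obtain ⟨hq, hj⟩ := Gate.mem_legs_tensor.1 h
      exact hj.imp id (hgate hq)
    · rcases ih _ T hT h with hj | ⟨U, hU, h⟩
      · split_ifs at hj with hq
        · exact Or.inr (hgate hq hj)
        · exact Or.inl hj
      · exact Or.inr ⟨U, List.mem_cons_of_mem _ hU, h⟩

theorem endpoints_append {E : Type*} [DecidableEq E] (N N' : Network E) (e : E) :
    endpoints (N ++ N') e = endpoints N e + endpoints N' e :=
  List.countP_append

theorem endpoints_ofFn_zeroTensor_le (c : Fin n → ℕ) (q : Fin n) (j : ℕ) :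
    endpoints (List.ofFn fun q => zeroTensor (q, c q)) (q, j) ≤ if j = c q then 1 else 0 := by
  rw [endpoints, List.ofFn_eq_map, List.countP_map]
  split_ifs with h
  · refine le_trans ?_ (List.nodup_iff_count_le_one.1 (List.nodup_finRange n) q)
    refine List.countP_mono_left fun r _ hr => ?_
    have := mem_legs_zeroTensor.1 (of_decide_eq_true hr)
    simp only [Prod.mk.injEq] at this
    simp [this.1]
  · rw [Nat.le_zero, List.countP_eq_zero]
    intro r _ hr
    have := mem_legs_zeroTensor.1 (of_decide_eq_true hr)
    simp only [Prod.mk.injEq] at this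
    exact h (this.1 ▸ this.2)

theorem endpoints_networkFrom_le (gs : List (Gate n)) (c : Fin n → ℕ) (q : Fin n) (j : ℕ) :
    endpoints (networkFrom c gs) (q, j) ≤ if j < c q then 0 else if j = c q then 1 else 2 := by
  induction gs generalizing c with
  | nil =>
    refine (endpoints_ofFn_zeroTensor_le c q j).trans ?_
    split_ifs <;> omega
  | cons g gs ih =>
    have h := ih (fun q => if q ∈ g.support then c q + 1 else c q)
    have hcons : endpoints (networkFrom c (g :: gs)) (q, j) =
      endpoints (networkFrom (fun q => if q ∈ g.support then c q + 1 else c q) gs) (q, j) +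
        if q ∈ g.support ∧ (j = c q ∨ j = c q + 1) then 1 else 0 := by
      rw [endpoints, networkFrom, List.countP_cons]
      simp only [decide_eq_true_eq, Gate.mem_legs_tensor]
      rfl
    rw [hcons]
    by_cases hq : q ∈ g.support
    · simp only [hq, if_true, true_and] at h ⊢
      split_ifs at h ⊢ <;> omega
    · simp only [hq, if_false, false_and] at h ⊢
      exact h

theorem endpoints_circuitNetwork_le (C : List (Gate n)) (e : Segment n) :
    endpoints (circuitNetwork C) e ≤ 2 := by
  obtain ⟨q, j⟩ := e
  have h₁ := endpoints_ofFn_zeroTensor_le (fun _ => 0) q j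
  have h₂ := endpoints_networkFrom_le C (fun _ => 0) q j
  rw [circuitNetwork, endpoints_append]
  split_ifs at h₁ h₂ <;> omega

theorem exists_source_circuitNetwork (C : List (Gate n)) {q : Fin n} {j : ℕ} :
    ∀ T ∈ circuitNetwork C, (q, j) ∈ T.legs → j = 0 ∨
      ∃ U ∈ circuitNetwork C, (q, j) ∈ U.legs ∧ ∃ i, j = i + 1 ∧ (q, i) ∈ U.legs := by
  intro T hT h
  rcases List.mem_append.1 hT with hT | hT
  · obtain ⟨r, rfl⟩ := List.mem_ofFn.1 hT
    exact Or.inl (Prod.mk.injEq .. ▸ mem_legs_zeroTensor.1 h).2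
  · exact (exists_source_networkFrom C _ T hT h).imp id
      fun ⟨U, hU, h⟩ => ⟨U, List.mem_append_right _ hU, h⟩

theorem exists_legsAt_eq {E : Type*} {N : Network E} {T : Tensor E} (hT : T ∈ N) :
    ∃ v, legsAt N v = T.legs := by
  obtain ⟨v, rfl⟩ := List.mem_iff_get.1 hT
  exact ⟨v, rfl⟩

/-- A set of vertices without boundary edges on a wire contains all or none of its vertices, since
every vertex is linked to the start of the wire. -/
theorem circuitNetwork_connected (C : List (Gate n)) (q : Fin n)
    (S : Finset (Fin (circuitNetwork C).length))
    (hS : q ∈ wiresHit (legsAt (circuitNetwork C)) S)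
    (hS' : ¬ ContainsWire (legsAt (circuitNetwork C)) S q) :
    ∃ v ∈ S, ∃ u ∉ S, ∃ j, (q, j) ∈ legsAt (circuitNetwork C) v ∧
      (q, j) ∈ legsAt (circuitNetwork C) u := by
  by_contra! hno
  have hsame : ∀ v u j, (q, j) ∈ legsAt (circuitNetwork C) v →
      (q, j) ∈ legsAt (circuitNetwork C) u → (v ∈ S ↔ u ∈ S) := by
    intro v u j hv hu
    constructor
    · intro h
      by_contra h'
      exact hno v h u h' j hv hu
    · intro h
      by_contra h'
      exact hno u h v h' j hu hv
  have hwire : ∀ j v u, (q, j) ∈ legsAt (circuitNetwork C) v →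
      (q, 0) ∈ legsAt (circuitNetwork C) u → (v ∈ S ↔ u ∈ S) := by
    intro j
    induction j with
    | zero => exact fun v u => hsame v u 0
    | succ j ih =>
      intro v u hv hu
      rcases exists_source_circuitNetwork C _ (List.get_mem _ v) hv with h | ⟨U, hU, hj, i, hi, hi'⟩
      · omega
      · obtain ⟨w, hw⟩ := exists_legsAt_eq hU
        obtain rfl : j = i := by omega
        rw [← hw] at hj hi'
        exact (hsame v w _ hv hj).trans (ih w u hi' hu)
  have hz : zeroTensor (q, 0) ∈ circuitNetwork C :=
    List.mem_append_left _ (List.mem_ofFn.2 ⟨q, rfl⟩)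
  obtain ⟨u, hu⟩ := exists_legsAt_eq hz
  have hu : (q, 0) ∈ legsAt (circuitNetwork C) u := hu ▸ mem_legs_zeroTensor.2 rfl
  obtain ⟨v, hvS, hv⟩ := mem_biUnion.1 hS
  obtain ⟨⟨r, j⟩, hj, rfl⟩ := mem_image.1 hv
  refine hS' fun w hw => ?_
  obtain ⟨⟨r', i⟩, hi, hr⟩ := mem_image.1 hw
  obtain rfl : r' = r := hr
  exact (hwire i w u hi hu).2 ((hwire j v u hj hu).1 hvS)

theorem iqpNetwork_isWiring {D : List (Finset (Fin n))} (hD : ∀ s ∈ D, s.card ≤ 3)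
    {a : Fin n → Prop} (ha : ∃ q, a q) (ha' : ∃ q, ¬ a q)
    (hcross : ∀ q r, a q → ¬ a r → {q, r} ∈ D) : IsWiring (legsAt (iqpNetwork D)) a := by
  have hgate : ∀ g ∈ iqpCircuit D, ∃ v c, legsAt (iqpNetwork D) v = (g.tensor c).legs := by
    intro g hg
    obtain ⟨c, hc⟩ := exists_tensor_mem_networkFrom hg fun _ => 0
    obtain ⟨v, hv⟩ := exists_legsAt_eq (List.mem_append_right _ hc)
    exact ⟨v, c, hv⟩
  have hphase : ∀ s ∈ D, ∃ v, ∀ q, q ∈ (legsAt (iqpNetwork D) v).image Prod.fst ↔ q ∈ s := by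
    intro s hs
    obtain ⟨v, c, hv⟩ := hgate (Gate.phase s) (by simp [iqpCircuit, hs])
    exact ⟨v, fun q => by rw [hv, Gate.mem_wires_tensor]; rfl⟩
  have hpair : ∀ q, ∃ r, r ≠ q ∧ ∃ s ∈ D, q ∈ s ∧ r ∈ s := by
    intro q
    obtain ⟨r₁, h₁⟩ := ha
    obtain ⟨r₂, h₂⟩ := ha'
    by_cases hq : a q
    · exact ⟨r₂, fun h => h₂ (h ▸ hq), _, hcross q r₂ hq h₂, by simp, by simp⟩
    · exact ⟨r₁, fun h => hq (h ▸ h₁), _, hcross r₁ q h₁ hq, by simp, by simp⟩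
  refine ⟨circuitNetwork_connected _, fun q S hS => ?_, fun v => ?_, fun q r hq hr => ?_⟩
  · -- The input, a Hadamard gate and a controlled phase gate are three vertices on the wire.
    have hz : zeroTensor (q, 0) ∈ iqpNetwork D :=
      List.mem_append_left _ (List.mem_ofFn.2 ⟨q, rfl⟩)
    obtain ⟨u, hu⟩ := exists_legsAt_eq hz
    obtain ⟨v, c, hv⟩ := hgate (Gate.had q) (by simp [iqpCircuit])
    obtain ⟨r, hrq, s, hs, hqs, hrs⟩ := hpair q
    obtain ⟨w, hw⟩ := hphase s hs
    have hqu : (legsAt (iqpNetwork D) u).image Prod.fst = {q} := hu ▸ wires_zeroTensor _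
    have hqv : (legsAt (iqpNetwork D) v).image Prod.fst = {q} := by
      ext r
      rw [hv, Gate.mem_wires_tensor]
      rfl
    refine two_lt_card.2 ⟨u, hS u (by simp [hqu]), v, hS v (by simp [hqv]), w,
      hS w ((hw q).2 hqs), ?_, ?_, ?_⟩
    · rintro rfl
      have h := hu.symm.trans hv
      have h₁ : (q, c q) = (q, 0) := mem_legs_zeroTensor.1
        (h ▸ Gate.mem_legs_tensor.2 ⟨mem_singleton_self q, Or.inl rfl⟩)
      have h₂ : (q, c q + 1) = (q, 0) := mem_legs_zeroTensor.1
        (h ▸ Gate.mem_legs_tensor.2 ⟨mem_singleton_self q, Or.inr rfl⟩)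
      simp at h₂
    · rintro rfl
      exact hrq (mem_singleton.1 (hqu ▸ (hw r).2 hrs))
    · rintro rfl
      exact hrq (mem_singleton.1 (hqv ▸ (hw r).2 hrs))
  · have hz : ∀ l : Segment n, ((zeroTensor l).legs.image Prod.fst).card ≤ 3 := fun l => by
      simp [wires_zeroTensor]
    have hg : ∀ g ∈ iqpCircuit D, ∀ c, ((g.tensor c).legs.image Prod.fst).card ≤ 3 := by
      intro g hg c
      have : (g.tensor c).legs.image Prod.fst = g.support :=
        Finset.ext fun _ => Gate.mem_wires_tensor
      rw [this]
      cases g with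
      | had q => simp [Gate.support]
      | phase s => exact hD s (by simpa [iqpCircuit] using hg)
    rcases List.mem_append.1 (List.get_mem (iqpNetwork D) v) with h | h
    · obtain ⟨r, hr⟩ := List.mem_ofFn.1 h
      rw [legsAt, ← hr]
      exact hz _
    · exact forall_mem_networkFrom (p := fun T => (T.legs.image Prod.fst).card ≤ 3) hz hg _ _ h
  · obtain ⟨v, hv⟩ := hphase _ (hcross q r hq hr)
    exact ⟨v, (hv q).2 (by simp), (hv r).2 (by simp)⟩

end Circuits

/-! ### The gates of the circuit -/

section Polynomial

variable {n : ℕ}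

/-- The indicator vector of a set of variables. -/
def indicatorVec (T : Finset (Fin n)) (q : Fin n) : ZMod 2 :=
  if q ∈ T then 1 else 0

theorem prod_indicatorVec (s T : Finset (Fin n)) :
    ∏ q ∈ s, indicatorVec T q = if s ⊆ T then 1 else 0 := by
  simp only [indicatorVec, prod_ite_zero, prod_const_one]
  exact if_congr Iff.rfl rfl rfl

theorem linearNetworkPoly_indicatorVec {k : ℕ} {α : Fin n → ZMod 2}
    {M : ℕ → Finset (Finset (Fin n))} (hM : IsWindowCubic k M) {T : Finset (Fin n)}
    (hT : T.card ≤ 2) :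
    linearNetworkPoly k α M (indicatorVec T) = (∑ i ∈ T, α i) * T.card := by
  have hcubic : ∑ s ∈ range (n + 1 - k), ∑ t ∈ M s, ∏ i ∈ t, indicatorVec T i = 0 := by
    refine sum_eq_zero fun s hs => sum_eq_zero fun t ht => ?_
    rw [prod_indicatorVec, if_neg]
    intro h
    have := card_le_card h
    have := (hM s (mem_range.1 hs) t ht).1
    omega
  rw [linearNetworkPoly, hcubic]
  simp [indicatorVec]

/-- The coefficient of `x q * x r` in a polynomial is its second difference at the origin, which
for the linear-network polynomial is `α q + α r`. -/
theorem pair_mem_of_represents {k : ℕ} {α : Fin n → ZMod 2} {M : ℕ → Finset (Finset (Fin n))}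
    {D : List (Finset (Fin n))} (hM : IsWindowCubic k M)
    (hD : Represents D (linearNetworkPoly k α M)) {q r : Fin n} (h : α q ≠ α r) :
    {q, r} ∈ D := by
  have hqr : q ≠ r := fun hqr => h (hqr ▸ rfl)
  by_contra hno
  have hmono : ∀ s ∈ D, ∏ i ∈ s, indicatorVec {q, r} i =
      ∏ i ∈ s, indicatorVec {q} i + ∏ i ∈ s, indicatorVec {r} i := by
    intro s hs
    have hne : s ≠ ∅ := fun h => by simpa [h] using (hD.1 s hs).1
    have hs' : s ≠ {q, r} := fun h => hno (h ▸ hs)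
    have hpair : s ⊆ {q, r} ↔ s = {q} ∨ s = {r} := by
      constructor
      · intro h
        grind
      · rintro (rfl | rfl) <;> simp
    simp only [prod_indicatorVec, hpair, subset_singleton_iff, hne, false_or]
    by_cases h₁ : s = {q} <;> by_cases h₂ : s = {r}
    · exact absurd (singleton_injective (h₁.symm.trans h₂)) hqr
    all_goals simp [h₁, h₂]
    all_goals simp [hqr, Ne.symm hqr]
  have hsum : linearNetworkPoly k α M (indicatorVec {q, r}) =
      linearNetworkPoly k α M (indicatorVec {q}) + linearNetworkPoly k α M (indicatorVec {r}) := by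
    rw [← hD.2, ← hD.2, ← hD.2, ← List.sum_map_add]
    exact congrArg List.sum (List.map_congr_left hmono)
  rw [linearNetworkPoly_indicatorVec hM (card_pair hqr).le,
    linearNetworkPoly_indicatorVec hM (by simp), linearNetworkPoly_indicatorVec hM (by simp),
    card_pair hqr, sum_pair hqr] at hsum
  simp only [sum_singleton, card_singleton, Nat.cast_one, mul_one, Nat.cast_ofNat] at hsum
  revert h hsum
  generalize α q = x
  generalize α r = y
  revert x y
  decide

/-- Every run on the network of the circuit forms a merged vertex of degree at least
`(min w (n - w) - 1) / 2`. -/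
theorem le_runDegree_iqpNetwork {k : ℕ} {α : Fin n → ZMod 2} {M : ℕ → Finset (Finset (Fin n))}
    {D : List (Finset (Fin n))} (hM : IsWindowCubic k M)
    (hD : Represents D (linearNetworkPoly k α M)) {σ : List (Finset (Segment n))}
    (hσ : IsRun (iqpNetwork D) σ) :
    (min (hammingNorm α : ℝ) (n - hammingNorm α) - 1) / 2 ≤ (runDegree (iqpNetwork D) σ : ℝ) := by
  set m := min (hammingNorm α) (n - hammingNorm α) with hm
  have hle : hammingNorm α ≤ n := by simpa using hammingNorm_le_card_fintype (x := α)
  have hmR : (m : ℝ) = min (hammingNorm α : ℝ) (n - hammingNorm α) := by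
    rw [hm, Nat.cast_min, Nat.cast_sub hle]
  rw [← hmR]
  by_contra! hlt
  have hlt' : 2 * runDegree (iqpNetwork D) σ + 1 < m := by
    have : (2 * runDegree (iqpNetwork D) σ + 1 : ℝ) < m := by linarith
    exact_mod_cast this
  have hw : #{q | α q ≠ 0} = hammingNorm α := rfl
  have hn : #{q | α q ≠ 0} + #{q | ¬ α q ≠ 0} = n := by
    rw [card_filter_add_card_filter_not, card_univ, Fintype.card_fin]
  obtain ⟨q, hq⟩ : (univ.filter fun q => α q ≠ 0).Nonempty := card_pos.1 (by omega)
  obtain ⟨r, hr⟩ : (univ.filter fun q => ¬ α q ≠ 0).Nonempty := card_pos.1 (by omega)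
  have hwiring : IsWiring (legsAt (iqpNetwork D)) fun q => α q ≠ 0 :=
    iqpNetwork_isWiring (fun s hs => (hD.1 s hs).2) ⟨q, (mem_filter.1 hq).2⟩
      ⟨r, (mem_filter.1 hr).2⟩ fun q r hq hr =>
        pair_mem_of_represents hM hD fun h => hr (h ▸ hq)
  have := lt_runDegree hwiring (endpoints_circuitNetwork_le _) (m := m)
    (b := runDegree (iqpNetwork D) σ) (by omega) (by omega) (by omega) (by omega) hσ
  omega

end Polynomial

end TN

/-- `hammingNorm α` is the number of `i` with `α i ≠ 0`. -/
theorem mainTheorem6 :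
    (∀ (n k : ℕ) (α : Fin n → ZMod 2) (M : ℕ → Finset (Finset (Fin n)))
        (D : List (Finset (Fin n))),
      TN.IsWindowCubic k M → TN.Represents D (TN.linearNetworkPoly k α M) →
        (min (hammingNorm α : ℝ) (n - hammingNorm α) - 1) / 2
          ≤ (TN.contractionComplexity (TN.iqpNetwork D) : ℝ)) ∧
    (∀ δ : ℝ, 0 < δ → ∃ ε : ℝ, 0 < ε ∧ ∃ N : ℕ, ∀ n : ℕ, N ≤ n →
      ∀ (k : ℕ) (α : Fin n → ZMod 2) (M : ℕ → Finset (Finset (Fin n)))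
        (D : List (Finset (Fin n))),
        TN.IsWindowCubic k M → TN.Represents D (TN.linearNetworkPoly k α M) →
        δ * n ≤ hammingNorm α → (hammingNorm α : ℝ) ≤ (1 - δ) * n →
          ∀ σ : List (Finset (TN.Segment n)), TN.IsRun (TN.iqpNetwork D) σ →
            (2 : ℝ) ^ (ε * n) ≤ (TN.time (TN.iqpNetwork D) σ : ℝ) ∧
            (2 : ℝ) ^ (ε * n) ≤ (TN.space (TN.iqpNetwork D) σ : ℝ)) := by
  refine ⟨fun n k α M D hM hD => ?_, fun δ hδ => ⟨δ / 4, by positivity, ⌈2 / δ⌉₊,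
    fun n hn k α M D hM hD hw₁ hw₂ σ hσ => ?_⟩⟩
  · obtain ⟨σ, hσ, h⟩ := TN.exists_run_contractionComplexity_eq (TN.iqpNetwork D)
    rw [h]
    exact TN.le_runDegree_iqpNetwork hM hD hσ
  · have hδn : 2 ≤ δ * n := by
      have := (Nat.ceil_le.1 hn)
      rwa [div_le_iff₀ hδ, mul_comm] at this
    have hmin : δ * n ≤ min (hammingNorm α : ℝ) (n - hammingNorm α) :=
      le_min hw₁ (by linarith)
    have hdeg := TN.le_runDegree_iqpNetwork hM hD hσ
    -- `δ n ≥ 2` makes `(δ n - 1) / 2` at least `δ n / 4`.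
    have hexp : δ / 4 * n ≤ TN.runDegree (TN.iqpNetwork D) σ := by linarith
    have hpos : 0 < TN.runDegree (TN.iqpNetwork D) σ := by
      have : (0 : ℝ) < TN.runDegree (TN.iqpNetwork D) σ := by linarith
      exact_mod_cast this
    have hpow : (2 : ℝ) ^ (δ / 4 * n) ≤ (2 ^ TN.runDegree (TN.iqpNetwork D) σ : ℕ) := by
      rw [Nat.cast_pow, Nat.cast_ofNat, ← Real.rpow_natCast]
      exact Real.rpow_le_rpow_of_exponent_le one_le_two hexp
    exact ⟨hpow.trans (Nat.cast_le.2 (TN.two_pow_le_time hσ hpos le_rfl)),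
      hpow.trans (Nat.cast_le.2 (TN.two_pow_le_space hpos le_rfl))⟩
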